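/- Let $q$ be a complex number with $|q|<1$. Write $(a;q)_n=\prod_{m=0}^{n-1}(1-aq^m)$ for integers $n\ge 0$, $(a;q)_\infty=\prod_{m=0}^{\infty}(1-aq^m)$, and $(a,b,c;q)_\infty=(a;q)_\infty(b;q)_\infty(c;q)_\infty$. Then the triple series below converges absolutely and $$\sum_{i,j,k\ge 0}\frac{q^{i^2+2j^2+4k^2+2ik+4jk+2j+2k}\left(1+q^{2i+2j+4k+2}\right)}{(q^2;q^2)_i\,(q^2;q^2)_j\,(q^4;q^4)_k}=\frac{(q^3,q^8,q^{11};q^{11})_\infty}{(q;q^2)_\infty\,(q^4;q^4)_\infty}.$$ -/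

import Mathlib

/-- The finite `q`-shifted factorial `(a;q)_n = (1 - a)(1 - a q) ⋯ (1 - a q^(n-1))`. -/
noncomputable def qPoch (a q : ℂ) (n : ℕ) : ℂ :=
  ∏ k ∈ Finset.range n, (1 - a * q ^ k)

/-- The infinite `q`-shifted factorial `(a;q)_∞ = ∏_{k ≥ 0} (1 - a q^k)`, used for `‖q‖ < 1`,
where the product converges absolutely (see `multipliable_qPochInf`). -/
noncomputable def qPochInf (a q : ℂ) : ℂ :=
  ∏' k : ℕ, (1 - a * q ^ k)

/-- The infinite product defining `(a;q)_∞` converges for `‖q‖ < 1`. -/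
theorem multipliable_qPochInf (a q : ℂ) (hq : ‖q‖ < 1) :
    Multipliable (fun k : ℕ => 1 - a * q ^ k) := by
  have h : Summable (fun k : ℕ => ‖-(a * q ^ k)‖) := by
    simp only [norm_neg, norm_mul, norm_pow]
    exact (summable_geometric_of_lt_one (norm_nonneg q) hq).mul_left _
  simpa [sub_eq_add_neg] using multipliable_one_add_of_summable h

/-- The compressed notation `(a, b, c; q)_∞ = (a;q)_∞ (b;q)_∞ (c;q)_∞`. -/
noncomputable def qPochInf₃ (a b c q : ℂ) : ℂ :=
  qPochInf a q * qPochInf b q * qPochInf c q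

/-!
Put `p² = q` and `Q = q² = p⁴`. Euler's identity `∑ᵢ xⁱ² zⁱ / (x²;x²)ᵢ = (-xz;x²)_∞` with `x = q`
sums the two halves of the series over `i`; what remains contains `(q⁴;q⁴)ₖ (-q;q²)ₖ` and
`(q⁴;q⁴)ₖ (-q;q²)ₖ₊₁` in the denominators, which are the Bailey sums of
`αᵣ = (-1)ʳ p^(3r²+r) = (-1)ʳ q^(r(3r+1)/2)` at the indices `(k, k)` and `(k, k+1)`. One step of the
Bailey lemma multiplies `αᵣ` by `Q^(r²)`. The factor `1 + q^(2i+2j+4k+2)` is exactly what is needed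
to merge the two resulting sums, at `(N, N)` and `(N, N+1)` with `N = j + k`, into the single one at
`(N, N+1)`. A second step, in its limiting form, multiplies by `Q^(r²+r)` and leaves the theta
series `∑ᵣ (-1)ʳ p^(11r²+5r)`, which the Jacobi triple product evaluates.

Both the `q`-Vandermonde sum behind the Bailey lemma and the finite form of the triple product are
Bailey sums, and both follow by induction from the two Pascal-type recurrences of `baileySum`.
-/

open Filter Topology

theorem norm_pow_lt_one {R : Type*} [SeminormedRing R] {a : R} (ha : ‖a‖ < 1) {n : ℕ}
    (hn : n ≠ 0) : ‖a ^ n‖ < 1 :=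
  (norm_pow_le' a (Nat.pos_of_ne_zero hn)).trans_lt (pow_lt_one₀ (norm_nonneg a) ha hn)

theorem summable_mul_of_norm_le {ι R : Type*} [NormedRing R] [CompleteSpace R] {f g : ι → R}
    {C : ℝ} (hf : Summable fun i => ‖f i‖) (hg : ∀ i, ‖g i‖ ≤ C) : Summable fun i => f i * g i :=
  .of_norm_bounded (hf.mul_right C) fun i => norm_mul_le_of_le le_rfl (hg i)

section qPoch

variable {a q : ℂ}

theorem qPoch_zero (a q : ℂ) : qPoch a q 0 = 1 := Finset.prod_range_zero _

theorem qPoch_succ (a q : ℂ) (n : ℕ) : qPoch a q (n + 1) = qPoch a q n * (1 - a * q ^ n) :=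
  Finset.prod_range_succ _ n

theorem one_sub_mul_pow_ne_zero (ha : ‖a‖ < 1) (hq : ‖q‖ < 1) (n : ℕ) : 1 - a * q ^ n ≠ 0 := by
  intro h
  have hlt : ‖a * q ^ n‖ < 1 := by
    rw [norm_mul, norm_pow]
    exact mul_lt_one_of_nonneg_of_lt_one_left (norm_nonneg a) ha
      (pow_le_one₀ (norm_nonneg q) hq.le)
  rw [← sub_eq_zero.1 h, norm_one] at hlt
  exact hlt.false

theorem qPoch_ne_zero (ha : ‖a‖ < 1) (hq : ‖q‖ < 1) (n : ℕ) : qPoch a q n ≠ 0 :=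
  Finset.prod_ne_zero_iff.2 fun k _ => one_sub_mul_pow_ne_zero ha hq k

theorem qPochInf_ne_zero (ha : ‖a‖ < 1) (hq : ‖q‖ < 1) : qPochInf a q ≠ 0 := by
  have hsum : Summable fun k : ℕ => ‖-(a * q ^ k)‖ := by
    simp only [norm_neg, norm_mul, norm_pow]
    exact (summable_geometric_of_lt_one (norm_nonneg q) hq).mul_left _
  simpa [qPochInf, sub_eq_add_neg] using tprod_one_add_ne_zero_of_summable
    (fun k => by simpa [sub_eq_add_neg] using one_sub_mul_pow_ne_zero ha hq k) hsum

theorem tendsto_qPoch (a : ℂ) (hq : ‖q‖ < 1) :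
    Tendsto (qPoch a q) atTop (𝓝 (qPochInf a q)) :=
  (multipliable_qPochInf a q hq).tendsto_prod_tprod_nat

theorem exists_norm_inv_qPoch_le (ha : ‖a‖ < 1) (hq : ‖q‖ < 1) :
    ∃ C : ℝ, ∀ n, ‖(qPoch a q n)⁻¹‖ ≤ C := by
  obtain ⟨C, hC⟩ := ((tendsto_qPoch a hq).inv₀ (qPochInf_ne_zero ha hq)).norm.bddAbove_range
  exact ⟨C, fun n => hC ⟨n, rfl⟩⟩

theorem qPoch_mul_qPochInf (a : ℂ) (hq : ‖q‖ < 1) (n : ℕ) :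
    qPoch a q n * qPochInf (a * q ^ n) q = qPochInf a q := by
  have htail (k : ℕ) : 1 - a * q ^ n * q ^ k = 1 - a * q ^ (k + n) := by ring
  have h : Multipliable fun k : ℕ => 1 - a * q ^ (k + n) := by
    simpa only [htail] using multipliable_qPochInf (a * q ^ n) q hq
  simpa only [qPochInf, qPoch, htail] using
    Multipliable.prod_mul_tprod_nat_mul' (f := fun k : ℕ => 1 - a * q ^ k) h

theorem qPochInf_neg_mul_qPochInf (a : ℂ) (hq : ‖q‖ < 1) :
    qPochInf (-a) q * qPochInf a q = qPochInf (a ^ 2) (q ^ 2) := by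
  rw [qPochInf, qPochInf, ← (multipliable_qPochInf _ q hq).tprod_mul (multipliable_qPochInf _ q hq)]
  exact tprod_congr fun k => by ring

theorem qPochInf_sq_mul_qPochInf_sq (a : ℂ) (hq : ‖q‖ < 1) :
    qPochInf a (q ^ 2) * qPochInf (a * q) (q ^ 2) = qPochInf a q := by
  have hq2 := norm_pow_lt_one hq two_ne_zero
  have heven (k : ℕ) : 1 - a * (q ^ 2) ^ k = 1 - a * q ^ (2 * k) := by rw [pow_mul]
  have hodd (k : ℕ) : 1 - a * q * (q ^ 2) ^ k = 1 - a * q ^ (2 * k + 1) := by ring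
  have h_even := multipliable_qPochInf a (q ^ 2) hq2
  have h_odd := multipliable_qPochInf (a * q) (q ^ 2) hq2
  simp only [heven] at h_even
  simp only [hodd] at h_odd
  simpa only [qPochInf, heven, hodd] using
    tprod_even_mul_odd (f := fun k : ℕ => 1 - a * q ^ k) h_even h_odd

theorem qPochInf_neg_mul_inv (hq : ‖q‖ < 1) :
    qPochInf (-q) (q ^ 2) * (qPochInf (q ^ 2) (q ^ 2))⁻¹ =
      (qPochInf q (q ^ 2) * qPochInf (q ^ 4) (q ^ 4))⁻¹ := by
  have hq2 := norm_pow_lt_one hq two_ne_zero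
  have hprod := qPochInf_sq_mul_qPochInf_sq (q ^ 2) hq2
  rw [← qPochInf_neg_mul_qPochInf q hq2, mul_assoc, ← pow_add, ← pow_mul] at hprod
  have hne := left_ne_zero_of_mul (hprod.trans_ne (qPochInf_ne_zero hq2 hq2))
  rw [← hprod, mul_inv, mul_inv_cancel_left₀ hne]

end qPoch

section invQPoch

variable {Q : ℂ}

/-- The reciprocal `1 / (Q;Q)_n`, extended by zero to negative `n`. The convention makes the
recurrence `invQPoch_sub_one` valid for every integer and lets all sums range over `ℤ`. -/
noncomputable def invQPoch (Q : ℂ) (n : ℤ) : ℂ :=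
  if n < 0 then 0 else (qPoch Q Q n.toNat)⁻¹

theorem invQPoch_of_neg (Q : ℂ) {n : ℤ} (hn : n < 0) : invQPoch Q n = 0 := if_pos hn

theorem invQPoch_natCast (Q : ℂ) (n : ℕ) : invQPoch Q n = (qPoch Q Q n)⁻¹ := by
  simp [invQPoch]

theorem invQPoch_zero (Q : ℂ) : invQPoch Q 0 = 1 := by
  simp [invQPoch, qPoch_zero]

theorem one_sub_zpow_natCast_succ_ne_zero (hQ : ‖Q‖ < 1) (n : ℕ) : 1 - Q ^ ((n : ℤ) + 1) ≠ 0 := by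
  rw [← Nat.cast_succ, zpow_natCast, pow_succ']
  exact one_sub_mul_pow_ne_zero hQ hQ n

theorem invQPoch_sub_one (hQ : ‖Q‖ < 1) (n : ℤ) :
    invQPoch Q (n - 1) = (1 - Q ^ n) * invQPoch Q n := by
  rcases lt_trichotomy n 0 with hn | rfl | hn
  · rw [invQPoch_of_neg Q hn, invQPoch_of_neg Q (by lia), mul_zero]
  · rw [invQPoch_of_neg Q (by lia), zpow_zero, sub_self, zero_mul]
  · obtain ⟨m, rfl⟩ : ∃ m : ℕ, n = m + 1 := ⟨(n - 1).toNat, by lia⟩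
    have hm := one_sub_mul_pow_ne_zero hQ hQ m
    rw [add_sub_cancel_right, ← Nat.cast_succ, invQPoch_natCast, invQPoch_natCast, qPoch_succ,
      zpow_natCast, pow_succ', mul_inv]
    field_simp

theorem exists_norm_invQPoch_le (hQ : ‖Q‖ < 1) : ∃ C : ℝ, ∀ n, ‖invQPoch Q n‖ ≤ C := by
  obtain ⟨C, hC⟩ := exists_norm_inv_qPoch_le hQ hQ
  refine ⟨C, fun n => ?_⟩
  unfold invQPoch
  split_ifs
  · exact norm_zero.trans_le ((norm_nonneg _).trans (hC 0))
  · exact hC _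

theorem tendsto_invQPoch (hQ : ‖Q‖ < 1) : Tendsto (invQPoch Q) atTop (𝓝 (qPochInf Q Q)⁻¹) := by
  have htoNat : Tendsto Int.toNat atTop atTop :=
    tendsto_atTop_atTop.2 fun b => ⟨b, fun a ha => by lia⟩
  refine (((tendsto_qPoch Q hQ).inv₀ (qPochInf_ne_zero hQ hQ)).comp htoNat).congr' ?_
  filter_upwards [eventually_ge_atTop 0] with n hn
  exact (if_neg hn.not_gt).symm

theorem tendsto_tsum_mul_invQPoch_sub (hQ : ‖Q‖ < 1) {f : ℤ → ℂ} (hf : Summable f) :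
    Tendsto (fun n : ℤ => ∑' r, f r * invQPoch Q (n - r)) atTop
      (𝓝 ((∑' r, f r) * (qPochInf Q Q)⁻¹)) := by
  obtain ⟨C, hC⟩ := exists_norm_invQPoch_le hQ
  rw [← tsum_mul_right]
  refine tendsto_tsum_of_dominated_convergence (hf.norm.mul_right C) (fun r => ?_)
    (.of_forall fun n r => norm_mul_le_of_le le_rfl (hC _))
  exact ((tendsto_invQPoch hQ).comp (tendsto_atTop_add_const_right _ (-r) tendsto_id)).const_mul _

end invQPoch

section thetaTerm

variable {x z : ℂ}

/-- The general term `x^(r²) z^r` of a bilateral theta series. -/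
noncomputable def thetaTerm (x z : ℂ) (r : ℤ) : ℂ := x ^ (r ^ 2) * z ^ r

theorem thetaTerm_zero (x z : ℂ) : thetaTerm x z 0 = 1 := by
  simp [thetaTerm]

theorem thetaTerm_natCast (x z : ℂ) (n : ℕ) : thetaTerm x z n = x ^ n ^ 2 * z ^ n := by
  rw [thetaTerm, ← Nat.cast_pow, zpow_natCast, zpow_natCast]

theorem thetaTerm_add (hx : x ≠ 0) (hz : z ≠ 0) (r s : ℤ) :
    thetaTerm x z (r + s) = thetaTerm x z r * thetaTerm x (x ^ (2 * r) * z) s := by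
  simp only [thetaTerm, mul_zpow, ← zpow_mul, zpow_add₀ hz]
  rw [show (r + s) ^ 2 = r ^ 2 + (s ^ 2 + 2 * r * s) by ring, zpow_add₀ hx, zpow_add₀ hx]
  ring

theorem thetaTerm_add_one (hx : x ≠ 0) (hz : z ≠ 0) (r : ℤ) :
    thetaTerm x z (r + 1) = x * z * (x ^ 2) ^ r * thetaTerm x z r := by
  rw [thetaTerm_add hx hz, thetaTerm, thetaTerm, one_pow, zpow_one, zpow_one, zpow_mul, zpow_ofNat]
  ring

theorem thetaTerm_neg (x z : ℂ) (r : ℤ) : thetaTerm x z (-r) = thetaTerm x z⁻¹ r := by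
  rw [thetaTerm, thetaTerm, neg_sq, zpow_neg, inv_zpow]

theorem zpow_mul_thetaTerm (x z w : ℂ) (r : ℤ) :
    w ^ r * thetaTerm x z r = thetaTerm x (w * z) r := by
  rw [thetaTerm, thetaTerm, mul_zpow, mul_left_comm]

theorem thetaTerm_neg_one_sub (hx : x ≠ 0) (hz : z ≠ 0) (r : ℤ) :
    thetaTerm x z (-1 - r) = x * z⁻¹ * thetaTerm x (x ^ 2 * z⁻¹) r := by
  rw [← neg_add', add_comm, thetaTerm_neg, thetaTerm_add_one hx (inv_ne_zero hz), mul_assoc,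
    zpow_mul_thetaTerm]

theorem thetaTerm_mul_thetaTerm (x y z w : ℂ) (r : ℤ) :
    thetaTerm x z r * thetaTerm y w r = thetaTerm (x * y) (z * w) r := by
  simp only [thetaTerm, mul_zpow]
  ring

theorem summable_thetaTerm_natCast (hx0 : x ≠ 0) (hx : ‖x‖ < 1) (hz : z ≠ 0) :
    Summable fun n : ℕ => thetaTerm x z n := by
  have hratio : Tendsto (fun n : ℕ => ‖x * z * (x ^ 2) ^ n‖) atTop (𝓝 0) := by
    simpa using ((tendsto_pow_atTop_nhds_zero_of_norm_lt_one
      (norm_pow_lt_one hx two_ne_zero)).const_mul (x * z)).norm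
  refine summable_of_ratio_norm_eventually_le one_half_lt_one ?_
  filter_upwards [hratio.eventually_le_const one_half_pos] with n hn
  rw [Nat.cast_succ, thetaTerm_add_one hx0 hz, norm_mul, zpow_natCast]
  gcongr

theorem summable_thetaTerm (hx0 : x ≠ 0) (hx : ‖x‖ < 1) (hz : z ≠ 0) :
    Summable (thetaTerm x z) := by
  refine .of_nat_of_neg (summable_thetaTerm_natCast hx0 hx hz) ?_
  simpa only [thetaTerm_neg] using summable_thetaTerm_natCast hx0 hx (inv_ne_zero hz)

end thetaTerm

section baileySum

variable {Q : ℂ}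

/-- The bilateral Bailey sum `β = ∑ᵣ αᵣ / ((Q;Q)_(n-r) (Q;Q)_(m+r))` of a sequence `α`. For
`m = n + e` this is, up to folding `r ↦ -e - r`, the sequence paired with `α` in a Bailey pair
relative to `Q^e`. Only the indices `-m ≤ r ≤ n` contribute. -/
noncomputable def baileySum (Q : ℂ) (α : ℤ → ℂ) (n m : ℤ) : ℂ :=
  ∑' r, α r * (invQPoch Q (n - r) * invQPoch Q (m + r))

theorem hasSum_baileySum (Q : ℂ) (α : ℤ → ℂ) (n m : ℤ) :
    HasSum (fun r => α r * (invQPoch Q (n - r) * invQPoch Q (m + r))) (baileySum Q α n m) := by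
  refine (summable_of_ne_finset_zero (s := Finset.Icc (-m) n) fun r hr => ?_).hasSum
  rcases lt_or_ge n r with hn | hn
  · rw [invQPoch_of_neg Q (by lia : n - r < 0), zero_mul, mul_zero]
  · have hm : m + r < 0 := by
      by_contra hm
      exact hr (Finset.mem_Icc.2 ⟨by lia, hn⟩)
    rw [invQPoch_of_neg Q hm, mul_zero, mul_zero]

theorem baileySum_of_add_neg (Q : ℂ) (α : ℤ → ℂ) {n m : ℤ} (h : n + m < 0) :
    baileySum Q α n m = 0 := by
  refine (tsum_congr fun r => ?_).trans tsum_zero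
  rcases lt_or_ge n r with hn | hn
  · rw [invQPoch_of_neg Q (by lia : n - r < 0), zero_mul, mul_zero]
  · rw [invQPoch_of_neg Q (by lia : m + r < 0), mul_zero, mul_zero]

theorem baileySum_zero_zero (Q : ℂ) (α : ℤ → ℂ) : baileySum Q α 0 0 = α 0 := by
  rw [baileySum, tsum_eq_single 0]
  · simp only [sub_zero, add_zero, invQPoch_zero, mul_one]
  · intro r hr
    rcases hr.lt_or_gt with hr | hr
    · rw [invQPoch_of_neg Q (by lia : 0 + r < 0), mul_zero, mul_zero]
    · rw [invQPoch_of_neg Q (by lia : 0 - r < 0), zero_mul, mul_zero]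

theorem baileySum_add (Q : ℂ) (α β : ℤ → ℂ) (n m : ℤ) :
    baileySum Q (fun r => α r + β r) n m = baileySum Q α n m + baileySum Q β n m := by
  rw [← ((hasSum_baileySum Q α n m).add (hasSum_baileySum Q β n m)).tsum_eq]
  exact tsum_congr fun r => add_mul _ _ _

theorem baileySum_const_mul (Q c : ℂ) (α : ℤ → ℂ) (n m : ℤ) :
    baileySum Q (fun r => c * α r) n m = c * baileySum Q α n m := by
  rw [baileySum, baileySum, ← tsum_mul_left]
  exact tsum_congr fun r => mul_assoc _ _ _

theorem baileySum_reflect (Q : ℂ) (α : ℤ → ℂ) (n m c : ℤ) :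
    baileySum Q α n m = baileySum Q (fun r => α (c - r)) (m + c) (n - c) := by
  rw [baileySum, ← (Equiv.subLeft c).tsum_eq]
  refine tsum_congr fun r => ?_
  rw [Equiv.subLeft_apply, mul_comm (invQPoch Q _), ← add_sub_assoc, sub_sub_eq_add_sub,
    sub_add_eq_add_sub]

theorem baileySum_shift (Q : ℂ) (α : ℤ → ℂ) (n m : ℤ) :
    baileySum Q α n m = baileySum Q (fun r => α (r + 1)) (n - 1) (m + 1) := by
  rw [baileySum, ← (Equiv.addRight 1).tsum_eq]
  refine tsum_congr fun r => ?_
  rw [Equiv.coe_addRight, sub_sub, add_comm 1 r, ← add_assoc m, add_right_comm m]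

theorem baileySum_sub_one_left (hQ : ‖Q‖ < 1) (α : ℤ → ℂ) (n m : ℤ) :
    baileySum Q α (n - 1) m = baileySum Q (fun r => (1 - Q ^ (n - r)) * α r) n m := by
  refine tsum_congr fun r => ?_
  rw [sub_right_comm, invQPoch_sub_one hQ]
  ring

theorem baileySum_sub_one_right (hQ : ‖Q‖ < 1) (α : ℤ → ℂ) (n m : ℤ) :
    baileySum Q α n (m - 1) = baileySum Q (fun r => (1 - Q ^ (m + r)) * α r) n m := by
  refine tsum_congr fun r => ?_
  rw [sub_add_eq_add_sub, invQPoch_sub_one hQ]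
  ring

theorem baileySum_sub_one_right_add (hQ0 : Q ≠ 0) (hQ : ‖Q‖ < 1) (α : ℤ → ℂ) (n m : ℤ) :
    baileySum Q α n (m - 1) + Q ^ m * baileySum Q (fun r => Q ^ r * α r) n m =
      baileySum Q α n m := by
  rw [baileySum_sub_one_right hQ, ← baileySum_const_mul, ← baileySum_add]
  refine tsum_congr fun r => ?_
  dsimp only
  rw [zpow_add₀ hQ0]
  ring

-- Split `1 - Q^(n+1+m) = (1 - Q^(m+r)) + Q^(m+r) (1 - Q^(n+1-r))` inside the sum.
theorem one_sub_zpow_mul_baileySum_add_one (hQ0 : Q ≠ 0) (hQ : ‖Q‖ < 1) (α : ℤ → ℂ) (n m : ℤ) :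
    (1 - Q ^ (n + 1 + m)) * baileySum Q α (n + 1) m =
      baileySum Q (fun r => α (r + 1) + Q ^ (m + r) * α r) n m := by
  have hshift := baileySum_shift Q α (n + 1) (m - 1)
  have hleft := baileySum_sub_one_left hQ (fun r => Q ^ (m + r) * α r) (n + 1) m
  rw [sub_add_cancel, add_sub_cancel_right] at hshift
  rw [add_sub_cancel_right] at hleft
  rw [baileySum_add, ← hshift, baileySum_sub_one_right hQ, hleft, ← baileySum_add,
    ← baileySum_const_mul]
  refine tsum_congr fun r => ?_
  rw [show n + 1 + m = (n + 1 - r) + (m + r) by ring, zpow_add₀ hQ0]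
  ring

-- Split `1 - Q^(n+1+m) = (1 - Q^(n+1-r)) + Q^(n+1-r) (1 - Q^(m+r))` inside the sum.
theorem one_sub_zpow_mul_baileySum_add_one' (hQ0 : Q ≠ 0) (hQ : ‖Q‖ < 1) (α : ℤ → ℂ) (n m : ℤ) :
    (1 - Q ^ (n + 1 + m)) * baileySum Q α (n + 1) m =
      baileySum Q (fun r => α r + Q ^ (n - r) * α (r + 1)) n m := by
  have hshift := baileySum_shift Q (fun r => Q ^ (n + 1 - r) * α r) (n + 1) (m - 1)
  have hleft := baileySum_sub_one_left hQ α (n + 1) m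
  simp only [sub_add_cancel, add_sub_cancel_right, add_sub_add_right_eq_sub] at hshift
  rw [add_sub_cancel_right] at hleft
  rw [baileySum_add, ← hshift, hleft, baileySum_sub_one_right hQ, ← baileySum_add,
    ← baileySum_const_mul]
  refine tsum_congr fun r => ?_
  rw [show n + 1 + m = (n + 1 - r) + (m + r) by ring, zpow_add₀ hQ0]
  ring

theorem baileySum_thetaTerm_mul_invQPoch (hQ0 : Q ≠ 0) (hQ : ‖Q‖ < 1) (s n : ℤ) :
    baileySum Q (fun t => thetaTerm Q (Q ^ s) t * invQPoch Q (t + s)) n 0 =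
      invQPoch Q n * invQPoch Q (n + s) := by
  rcases lt_or_ge n 0 with hn | hn
  · rw [baileySum_of_add_neg _ _ (by lia), invQPoch_of_neg Q hn, zero_mul]
  lift n to ℕ using hn
  induction n generalizing s with
  | zero =>
    rw [Nat.cast_zero, baileySum_zero_zero, thetaTerm_zero, one_mul, zero_add, invQPoch_zero,
      one_mul]
  | succ n ih =>
    have hα (t : ℤ) : thetaTerm Q (Q ^ s) (t + 1) * invQPoch Q (t + 1 + s) +
        Q ^ (0 + t) * (thetaTerm Q (Q ^ s) t * invQPoch Q (t + s)) =
          thetaTerm Q (Q ^ (s + 1)) t * invQPoch Q (t + (s + 1)) := by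
      have hI := invQPoch_sub_one hQ (t + (s + 1))
      rw [show t + (s + 1) - 1 = t + s by ring] at hI
      have hθ : thetaTerm Q (Q ^ (s + 1)) t = Q ^ t * thetaTerm Q (Q ^ s) t := by
        rw [zpow_mul_thetaTerm, zpow_add_one₀ hQ0, mul_comm]
      rw [thetaTerm_add_one hQ0 (zpow_ne_zero _ hQ0), hI, hθ, add_assoc t 1 s, add_comm 1 s,
        zero_add, zpow_add₀ hQ0 t, zpow_add_one₀ hQ0, sq, mul_zpow]
      ring
    have hrec := one_sub_zpow_mul_baileySum_add_one hQ0 hQ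
      (fun t => thetaTerm Q (Q ^ s) t * invQPoch Q (t + s)) n 0
    simp only [hα, ih, add_zero] at hrec
    have hI := invQPoch_sub_one hQ ((n : ℤ) + 1)
    rw [add_sub_cancel_right] at hI
    apply mul_left_cancel₀ (one_sub_zpow_natCast_succ_ne_zero hQ n)
    rw [Nat.cast_succ, hrec, hI, add_right_comm (n : ℤ) 1 s, add_assoc (n : ℤ) s 1, mul_assoc]

theorem tsum_thetaTerm_mul_invQPoch (hQ0 : Q ≠ 0) (hQ : ‖Q‖ < 1) (e N r : ℤ) :
    ∑' k, thetaTerm Q (Q ^ e) k * invQPoch Q (N - k) *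
        (invQPoch Q (k - r) * invQPoch Q (k + e + r)) =
      thetaTerm Q (Q ^ e) r * (invQPoch Q (N - r) * invQPoch Q (N + e + r)) := by
  have hV := baileySum_thetaTerm_mul_invQPoch hQ0 hQ (2 * r + e) (N - r)
  rw [show N - r + (2 * r + e) = N + e + r by ring] at hV
  rw [← hV, baileySum, ← tsum_mul_left, ← (Equiv.addRight r).tsum_eq]
  refine tsum_congr fun t => ?_
  dsimp only [Equiv.coe_addRight]
  rw [add_comm t r, thetaTerm_add hQ0 (zpow_ne_zero _ hQ0),
    ← zpow_add₀ hQ0, add_sub_cancel_left, sub_add_eq_sub_sub, zero_add,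
    show r + t + e + r = t + (2 * r + e) by ring]
  ring

theorem tsum_thetaTerm_mul_invQPoch_mul (hQ0 : Q ≠ 0) (hQ : ‖Q‖ < 1) (e r : ℤ) :
    ∑' k, thetaTerm Q (Q ^ e) k * (invQPoch Q (k - r) * invQPoch Q (k + e + r)) =
      thetaTerm Q (Q ^ e) r * (qPochInf Q Q)⁻¹ := by
  obtain ⟨C, hC⟩ := exists_norm_invQPoch_le hQ
  have hsum := summable_mul_of_norm_le (summable_thetaTerm hQ0 hQ (zpow_ne_zero e hQ0)).norm
    fun k => norm_mul_le_of_le (hC (k - r)) (hC (k + e + r))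
  have hleft := tendsto_tsum_mul_invQPoch_sub hQ hsum
  simp only [mul_right_comm _ _ (invQPoch Q (_ - _)), tsum_thetaTerm_mul_invQPoch hQ0 hQ] at hleft
  have hI := tendsto_invQPoch hQ
  have hright := (((hI.comp (tendsto_atTop_add_const_right atTop (-r) tendsto_id)).mul
    (hI.comp (tendsto_atTop_add_const_right atTop (e + r) tendsto_id))).const_mul
      (thetaTerm Q (Q ^ e) r))
  simp only [Function.comp_def, id, ← sub_eq_add_neg, ← add_assoc] at hright
  have h := tendsto_nhds_unique hleft hright
  rw [← mul_assoc] at h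
  exact mul_right_cancel₀ (inv_ne_zero (qPochInf_ne_zero hQ hQ)) h

theorem hasSum_mul_baileySum (hQ : ‖Q‖ < 1) {w α γ : ℤ → ℂ} {e : ℤ} (hw : Summable w)
    (hα : Summable α)
    (hγ : ∀ r, ∑' k, w k * (invQPoch Q (k - r) * invQPoch Q (k + e + r)) = γ r) :
    HasSum (fun k => w k * baileySum Q α k (k + e)) (∑' r, α r * γ r) := by
  obtain ⟨C, hC⟩ := exists_norm_invQPoch_le hQ
  have hsum : Summable (Function.uncurry fun k r : ℤ =>
      w k * α r * (invQPoch Q (k - r) * invQPoch Q (k + e + r))) :=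
    summable_mul_of_norm_le (hw.norm.mul_norm hα.norm)
      fun p => norm_mul_le_of_le (hC _) (hC _)
  have hinner (r : ℤ) : ∑' k, w k * α r * (invQPoch Q (k - r) * invQPoch Q (k + e + r)) =
      α r * γ r := by
    rw [← hγ, ← tsum_mul_left]
    exact tsum_congr fun k => by ring
  have hrow (k : ℤ) : HasSum (fun r => w k * α r * (invQPoch Q (k - r) * invQPoch Q (k + e + r)))
      (w k * baileySum Q α k (k + e)) := by
    simpa only [mul_assoc] using (hasSum_baileySum Q α k (k + e)).mul_left (w k)
  have hrows := hsum.hasSum.prod_fiberwise hrow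
  rwa [hsum.tsum_prod_uncurry fun k => (hrow k).summable,
    ← hsum.tsum_comm, tsum_congr hinner] at hrows

theorem hasSum_thetaTerm_mul_invQPoch_mul_baileySum (hQ0 : Q ≠ 0) (hQ : ‖Q‖ < 1) {α : ℤ → ℂ}
    (hα : Summable α) (e N : ℤ) :
    HasSum (fun k => thetaTerm Q (Q ^ e) k * invQPoch Q (N - k) * baileySum Q α k (k + e))
      (baileySum Q (fun r => thetaTerm Q (Q ^ e) r * α r) N (N + e)) := by
  obtain ⟨C, hC⟩ := exists_norm_invQPoch_le hQ
  have hw := summable_mul_of_norm_le (summable_thetaTerm hQ0 hQ (zpow_ne_zero e hQ0)).norm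
    fun k => hC (N - k)
  convert hasSum_mul_baileySum hQ hw hα (tsum_thetaTerm_mul_invQPoch hQ0 hQ e N) using 1
  exact tsum_congr fun r => by ring

theorem hasSum_thetaTerm_mul_baileySum (hQ0 : Q ≠ 0) (hQ : ‖Q‖ < 1) {α : ℤ → ℂ}
    (hα : Summable α) (e : ℤ) :
    HasSum (fun k => thetaTerm Q (Q ^ e) k * baileySum Q α k (k + e))
      ((qPochInf Q Q)⁻¹ * ∑' r, thetaTerm Q (Q ^ e) r * α r) := by
  rw [← tsum_mul_left]
  convert hasSum_mul_baileySum hQ (summable_thetaTerm hQ0 hQ (zpow_ne_zero e hQ0)) hα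
    (tsum_thetaTerm_mul_invQPoch_mul hQ0 hQ e) using 1
  exact tsum_congr fun r => by ring

theorem exists_norm_baileySum_le (hQ : ‖Q‖ < 1) {α : ℤ → ℂ} (hα : Summable α) :
    ∃ C : ℝ, ∀ n m, ‖baileySum Q α n m‖ ≤ C := by
  obtain ⟨C, hC⟩ := exists_norm_invQPoch_le hQ
  exact ⟨(∑' r, ‖α r‖) * (C * C), fun n m => tsum_of_norm_bounded
    (hα.norm.hasSum.mul_right (C * C)) fun r =>
      norm_mul_le_of_le le_rfl (norm_mul_le_of_le (hC _) (hC _))⟩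

end baileySum

section baileyChain

variable {Q : ℂ} {α : ℤ → ℂ}

/-- The double series obtained by iterating the Bailey lemma twice, relative to `1` at the inner
level `p.2` and to `Q` at the outer level `p.1`. -/
noncomputable def baileyChainTerm (Q : ℂ) (α : ℤ → ℂ) (p : ℤ × ℤ) : ℂ :=
  thetaTerm Q Q p.1 * invQPoch Q (p.1 - p.2) *
    (thetaTerm Q 1 p.2 * baileySum Q α p.2 p.2 +
      Q ^ (p.1 + 1) * (thetaTerm Q Q p.2 * baileySum Q α p.2 (p.2 + 1)))

theorem summable_baileyChainTerm (hQ0 : Q ≠ 0) (hQ : ‖Q‖ < 1) (hα : Summable α) :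
    Summable (baileyChainTerm Q α) := by
  obtain ⟨A, hA⟩ := exists_norm_invQPoch_le hQ
  obtain ⟨B, hB⟩ := exists_norm_baileySum_le hQ hα
  have hθ {z : ℂ} (hz : z ≠ 0) := (summable_thetaTerm hQ0 hQ hz).norm
  have hone := summable_mul_of_norm_le
    ((hθ hQ0).mul_norm (hθ one_ne_zero))
    fun p : ℤ × ℤ => norm_mul_le_of_le (hA (p.1 - p.2)) (hB p.2 p.2)
  have hQQ := summable_mul_of_norm_le
    ((hθ (mul_ne_zero hQ0 hQ0)).mul_norm (hθ hQ0))
    fun p : ℤ × ℤ => norm_mul_le_of_le (hA (p.1 - p.2)) (hB p.2 (p.2 + 1))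
  refine (hone.add (hQQ.mul_left Q)).congr fun p => ?_
  rw [baileyChainTerm, zpow_add_one₀ hQ0, ← zpow_mul_thetaTerm Q Q Q]
  ring

theorem hasSum_baileyChainTerm_snd (hQ0 : Q ≠ 0) (hQ : ‖Q‖ < 1) (hα : Summable α) (N : ℤ) :
    HasSum (fun k => baileyChainTerm Q α (N, k))
      (thetaTerm Q Q N * baileySum Q (fun r => thetaTerm Q 1 r * α r) N (N + 1)) := by
  have hone := hasSum_thetaTerm_mul_invQPoch_mul_baileySum hQ0 hQ hα 0 N
  have hQQ := hasSum_thetaTerm_mul_invQPoch_mul_baileySum hQ0 hQ hα 1 N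
  have hmerge := baileySum_sub_one_right_add hQ0 hQ (fun r => thetaTerm Q 1 r * α r) N (N + 1)
  simp only [zpow_zero, add_zero] at hone
  simp only [zpow_one] at hQQ
  simp only [add_sub_cancel_right, ← mul_assoc, zpow_mul_thetaTerm, mul_one] at hmerge
  rw [← hmerge]
  refine ((hone.add (hQQ.mul_left (Q ^ (N + 1)))).mul_left (thetaTerm Q Q N)).congr_fun
    fun k => ?_
  rw [baileyChainTerm]
  ring

theorem hasSum_baileyChainTerm (hQ0 : Q ≠ 0) (hQ : ‖Q‖ < 1) (hα : Summable α) :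
    HasSum (baileyChainTerm Q α) ((qPochInf Q Q)⁻¹ * ∑' r, thetaTerm (Q ^ 2) Q r * α r) := by
  have hsum := summable_baileyChainTerm hQ0 hQ hα
  have hone := summable_thetaTerm hQ0 hQ one_ne_zero
  have hα' : Summable fun r => thetaTerm Q 1 r * α r :=
    summable_mul_of_norm_le hone.norm fun r => hα.norm.le_tsum r fun _ _ => norm_nonneg _
  have houter := hasSum_thetaTerm_mul_baileySum hQ0 hQ hα' 1
  simp only [zpow_one, ← mul_assoc, thetaTerm_mul_thetaTerm, mul_one, ← sq] at houter
  rw [houter.unique (hsum.hasSum.prod_fiberwise (hasSum_baileyChainTerm_snd hQ0 hQ hα))]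
  exact hsum.hasSum

theorem hasSum_baileyChainTerm_natCast (hQ0 : Q ≠ 0) (hQ : ‖Q‖ < 1) (hα : Summable α) :
    HasSum (fun n : ℕ × ℕ => baileyChainTerm Q α ((n.1 + n.2 : ℕ), n.2))
      ((qPochInf Q Q)⁻¹ * ∑' r, thetaTerm (Q ^ 2) Q r * α r) := by
  have hinj : Function.Injective fun n : ℕ × ℕ => (((n.1 + n.2 : ℕ) : ℤ), (n.2 : ℤ)) := by
    rintro ⟨j, k⟩ ⟨j', k'⟩ h
    simp only [Prod.mk.injEq] at h ⊢
    lia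
  refine (hinj.hasSum_iff ?_).2 (hasSum_baileyChainTerm hQ0 hQ hα)
  rintro ⟨N, k⟩ hrange
  rcases lt_or_ge k 0 with hk | hk
  · rw [baileyChainTerm, baileySum_of_add_neg _ _ (by lia : k + k < 0),
      baileySum_of_add_neg _ _ (by lia : k + (k + 1) < 0)]
    simp only [mul_zero, add_zero]
  · have hN : N - k < 0 := not_le.1 fun hN =>
      hrange ⟨((N - k).toNat, k.toNat), Prod.ext (by dsimp only; lia) (by dsimp only; lia)⟩
    rw [baileyChainTerm, invQPoch_of_neg Q hN, mul_zero, zero_mul]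

end baileyChain

section jacobi

variable {x z : ℂ}

theorem baileySum_thetaTerm_mul_qPoch (hx0 : x ≠ 0) (hx : ‖x‖ < 1) (hz : z ≠ 0) (n m : ℕ) :
    baileySum (x ^ 2) (thetaTerm x z) n m * qPoch (x ^ 2) (x ^ 2) (n + m) =
      qPoch (-(x * z)) (x ^ 2) n *
        (baileySum (x ^ 2) (thetaTerm x z) 0 m * qPoch (x ^ 2) (x ^ 2) m) := by
  have hQ0 := pow_ne_zero 2 hx0
  induction n with
  | zero => rw [Nat.cast_zero, Nat.zero_add, qPoch_zero, one_mul]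
  | succ n ih =>
    have hα (r : ℤ) : thetaTerm x z r + (x ^ 2) ^ ((n : ℤ) - r) * thetaTerm x z (r + 1) =
        (1 - -(x * z) * (x ^ 2) ^ n) * thetaTerm x z r := by
      have hpow := zpow_ne_zero r hQ0
      rw [thetaTerm_add_one hx0 hz, zpow_sub₀ hQ0, zpow_natCast]
      field_simp
      ring
    have hrec := one_sub_zpow_mul_baileySum_add_one' hQ0 (norm_pow_lt_one hx two_ne_zero)
      (thetaTerm x z) n m
    simp only [hα, baileySum_const_mul] at hrec
    have hpow : (x ^ 2) ^ ((n : ℤ) + 1 + m) = x ^ 2 * (x ^ 2) ^ (n + m) := by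
      rw [add_right_comm, ← pow_succ']
      exact mod_cast zpow_natCast (x ^ 2) (n + m + 1)
    rw [hpow] at hrec
    rw [Nat.cast_succ, Nat.succ_add, qPoch_succ, qPoch_succ]
    linear_combination qPoch (x ^ 2) (x ^ 2) (n + m) * hrec + (1 + x * z * (x ^ 2) ^ n) * ih

theorem baileySum_thetaTerm_reflect (x z : ℂ) (n m : ℤ) :
    baileySum (x ^ 2) (thetaTerm x z) n m = baileySum (x ^ 2) (thetaTerm x z⁻¹) m n := by
  rw [baileySum_reflect _ _ _ _ 0]
  simp only [zero_sub, thetaTerm_neg, add_zero, sub_zero]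

theorem finite_jacobi_triple_product (hx0 : x ≠ 0) (hx : ‖x‖ < 1) (hz : z ≠ 0) (n m : ℕ) :
    baileySum (x ^ 2) (thetaTerm x z) n m * qPoch (x ^ 2) (x ^ 2) (n + m) =
      qPoch (-(x * z)) (x ^ 2) n * qPoch (-(x * z⁻¹)) (x ^ 2) m := by
  have hm := baileySum_thetaTerm_mul_qPoch hx0 hx (inv_ne_zero hz) m 0
  rw [Nat.cast_zero, baileySum_zero_zero, thetaTerm_zero, qPoch_zero, one_mul, mul_one,
    add_zero] at hm
  rw [baileySum_thetaTerm_mul_qPoch hx0 hx hz, baileySum_thetaTerm_reflect, hm]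

theorem hasSum_thetaTerm_mul_invQPoch_add (hx0 : x ≠ 0) (hx : ‖x‖ < 1) (hz : z ≠ 0) (m : ℕ) :
    HasSum (fun r => thetaTerm x z r * invQPoch (x ^ 2) (m + r))
      (qPochInf (-(x * z)) (x ^ 2) * qPoch (-(x * z⁻¹)) (x ^ 2) m) := by
  have hQ := norm_pow_lt_one hx two_ne_zero
  obtain ⟨C, hC⟩ := exists_norm_invQPoch_le hQ
  have hsum := summable_mul_of_norm_le (summable_thetaTerm hx0 hx hz).norm fun r => hC (m + r)
  have hpoch := (tendsto_qPoch (x ^ 2) hQ).comp (tendsto_add_atTop_nat m)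
  have hleft := ((tendsto_tsum_mul_invQPoch_sub hQ hsum).comp tendsto_natCast_atTop_atTop).mul hpoch
  rw [inv_mul_cancel_right₀ (qPochInf_ne_zero hQ hQ)] at hleft
  have hright := (tendsto_qPoch (-(x * z)) hQ).mul_const (qPoch (-(x * z⁻¹)) (x ^ 2) m)
  rw [← tendsto_nhds_unique (hleft.congr fun n => ?_) hright]
  · exact hsum.hasSum
  · rw [← finite_jacobi_triple_product hx0 hx hz]
    simp only [Function.comp_apply, baileySum, mul_assoc, mul_comm (invQPoch _ (m + _))]

theorem hasSum_pow_sq_mul_pow_div_qPoch (hx0 : x ≠ 0) (hx : ‖x‖ < 1) (hz : z ≠ 0) :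
    HasSum (fun i : ℕ => x ^ i ^ 2 * z ^ i / qPoch (x ^ 2) (x ^ 2) i)
      (qPochInf (-(x * z)) (x ^ 2)) := by
  have h := hasSum_thetaTerm_mul_invQPoch_add hx0 hx hz 0
  rw [qPoch_zero, mul_one] at h
  have hsupp : ∀ r ∉ Set.range ((↑) : ℕ → ℤ),
      thetaTerm x z r * invQPoch (x ^ 2) ((0 : ℕ) + r) = 0 := by
    intro r hr
    have hr : r < 0 := not_le.1 fun h0 => hr ⟨r.toNat, Int.toNat_of_nonneg h0⟩
    rw [Nat.cast_zero, zero_add, invQPoch_of_neg _ hr, mul_zero]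
  convert (Nat.cast_injective.hasSum_iff hsupp).2 h using 2 with i
  rw [Function.comp_apply, Nat.cast_zero, zero_add, invQPoch_natCast, thetaTerm_natCast,
    div_eq_mul_inv]

theorem jacobi_triple_product (hx0 : x ≠ 0) (hx : ‖x‖ < 1) (hz : z ≠ 0) :
    ∑' r, thetaTerm x z r =
      qPochInf (-(x * z)) (x ^ 2) * qPochInf (-(x * z⁻¹)) (x ^ 2) * qPochInf (x ^ 2) (x ^ 2) := by
  have hQ := norm_pow_lt_one hx two_ne_zero
  have hfinite (m : ℕ) : ∑' r, thetaTerm x z r * invQPoch (x ^ 2) (m - r) =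
      qPoch (-(x * z)) (x ^ 2) m * qPochInf (-(x * z⁻¹)) (x ^ 2) := by
    have h := (hasSum_thetaTerm_mul_invQPoch_add hx0 hx (inv_ne_zero hz) m).tsum_eq
    rw [← (Equiv.neg ℤ).tsum_eq, inv_inv, mul_comm] at h
    simpa only [Equiv.neg_apply, thetaTerm_neg, inv_inv, ← sub_eq_add_neg] using h
  have hleft := (tendsto_tsum_mul_invQPoch_sub hQ (summable_thetaTerm hx0 hx hz)).comp
    tendsto_natCast_atTop_atTop
  have hright := (tendsto_qPoch (-(x * z)) hQ).mul_const (qPochInf (-(x * z⁻¹)) (x ^ 2))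
  rw [← tendsto_nhds_unique (hleft.congr hfinite) hright,
    inv_mul_cancel_right₀ (qPochInf_ne_zero hQ hQ)]

end jacobi

section baileyPair

variable {p : ℂ}

theorem baileySum_thetaTerm_self (hp0 : p ≠ 0) (hp : ‖p‖ < 1) (n : ℕ) :
    baileySum (p ^ 4) (thetaTerm (p ^ 3) (-p)) n n =
      (1 - -p ^ 2 * (p ^ 4) ^ n) * baileySum (p ^ 4) (thetaTerm (p ^ 3) (-p)) n (n + 1) := by
  have hQ0 := pow_ne_zero 4 hp0
  have hreflect : baileySum (p ^ 4) (thetaTerm (p ^ 3) (p ^ 4 * -p)) n (n + 1) =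
      -(p ^ 2)⁻¹ * baileySum (p ^ 4) (thetaTerm (p ^ 3) (-p)) n (n + 1) := by
    have hz : (p ^ 3) ^ 2 * (p ^ 4 * -p)⁻¹ = -p := by field_simp
    have hc : p ^ 3 * (p ^ 4 * -p)⁻¹ = -(p ^ 2)⁻¹ := by field_simp
    rw [baileySum_reflect _ _ _ _ (-1)]
    simp only [thetaTerm_neg_one_sub (pow_ne_zero 3 hp0) (mul_ne_zero hQ0 (neg_ne_zero.2 hp0)),
      hz, hc, baileySum_const_mul, sub_neg_eq_add, ← sub_eq_add_neg, add_sub_cancel_right]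
  have hmerge := baileySum_sub_one_right_add hQ0 (norm_pow_lt_one hp four_ne_zero)
    (thetaTerm (p ^ 3) (-p)) n (n + 1)
  simp only [zpow_mul_thetaTerm, hreflect, add_sub_cancel_right, zpow_add_one₀ hQ0,
    zpow_natCast] at hmerge
  rw [eq_sub_of_add_eq hmerge]
  field_simp

theorem one_sub_mul_baileySum_thetaTerm_succ (hp0 : p ≠ 0) (hp : ‖p‖ < 1) (n : ℕ) :
    (1 - p ^ 8 * (p ^ 8) ^ n) * baileySum (p ^ 4) (thetaTerm (p ^ 3) (-p)) (n + 1) (n + 1) =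
      baileySum (p ^ 4) (thetaTerm (p ^ 3) (-p)) n (n + 1) := by
  have hQ0 := pow_ne_zero 4 hp0
  have hp3 := pow_ne_zero 3 hp0
  have hodd : baileySum (p ^ 4) (thetaTerm (p ^ 3) (-p ^ 3)) n (n + 1) = 0 := by
    have hz : (p ^ 3) ^ 2 * (-p ^ 3)⁻¹ = -p ^ 3 := by field_simp
    have hc : p ^ 3 * (-p ^ 3)⁻¹ = -1 := by field_simp
    have h := baileySum_reflect (p ^ 4) (thetaTerm (p ^ 3) (-p ^ 3)) n (n + 1) (-1)
    simp only [thetaTerm_neg_one_sub hp3 (neg_ne_zero.2 hp3), hz, hc, baileySum_const_mul,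
      sub_neg_eq_add, ← sub_eq_add_neg, add_sub_cancel_right] at h
    exact self_eq_neg.1 (h.trans (neg_one_mul _))
  have hα (r : ℤ) : thetaTerm (p ^ 3) (-p) r +
      (p ^ 4) ^ ((n : ℤ) - r) * thetaTerm (p ^ 3) (-p) (r + 1) =
        thetaTerm (p ^ 3) (-p) r + -(p ^ 4) ^ (n + 1) * thetaTerm (p ^ 3) (-p ^ 3) r := by
    have hpow := zpow_ne_zero r hQ0
    rw [thetaTerm_add_one hp3 (neg_ne_zero.2 hp0), zpow_sub₀ hQ0,
      show -p ^ 3 = p ^ 2 * -p by ring, ← zpow_mul_thetaTerm,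
      show (p ^ 3) ^ 2 = p ^ 4 * p ^ 2 by ring, mul_zpow, zpow_natCast]
    field_simp
    ring
  have hrec := one_sub_zpow_mul_baileySum_add_one' hQ0 (norm_pow_lt_one hp four_ne_zero)
    (thetaTerm (p ^ 3) (-p)) n (n + 1)
  simp only [hα, baileySum_add, baileySum_const_mul, hodd, mul_zero, add_zero] at hrec
  rw [← hrec, zpow_add₀ hQ0, zpow_add_one₀ hQ0, zpow_natCast]
  ring

theorem baileySum_thetaTerm_self_eq_inv (hp0 : p ≠ 0) (hp : ‖p‖ < 1) (n : ℕ) :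
    baileySum (p ^ 4) (thetaTerm (p ^ 3) (-p)) n n =
      (qPoch (p ^ 8) (p ^ 8) n * qPoch (-p ^ 2) (p ^ 4) n)⁻¹ := by
  have hp8 := norm_pow_lt_one hp (n := 8) (by decide)
  have hp2 : ‖-p ^ 2‖ < 1 := (norm_neg _).trans_lt (norm_pow_lt_one hp two_ne_zero)
  induction n with
  | zero => rw [Nat.cast_zero, baileySum_zero_zero, thetaTerm_zero, qPoch_zero, qPoch_zero,
      mul_one, inv_one]
  | succ n ih =>
    have h8 := one_sub_mul_pow_ne_zero hp8 hp8 n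
    have h2 := one_sub_mul_pow_ne_zero hp2 (norm_pow_lt_one hp four_ne_zero) n
    have hrec := one_sub_mul_baileySum_thetaTerm_succ hp0 hp n
    rw [baileySum_thetaTerm_self hp0 hp, ← hrec] at ih
    rw [Nat.cast_succ, qPoch_succ, qPoch_succ, mul_mul_mul_comm, mul_inv,
      eq_mul_inv_iff_mul_eq₀ (mul_ne_zero h8 h2), ← ih]
    ring

theorem baileySum_thetaTerm_add_one_eq_inv (hp0 : p ≠ 0) (hp : ‖p‖ < 1) (n : ℕ) :
    baileySum (p ^ 4) (thetaTerm (p ^ 3) (-p)) n (n + 1) =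
      (qPoch (p ^ 8) (p ^ 8) n * qPoch (-p ^ 2) (p ^ 4) (n + 1))⁻¹ := by
  have hp2 : ‖-p ^ 2‖ < 1 := (norm_neg _).trans_lt (norm_pow_lt_one hp two_ne_zero)
  have h2 := one_sub_mul_pow_ne_zero hp2 (norm_pow_lt_one hp four_ne_zero) n
  have hself := baileySum_thetaTerm_self_eq_inv hp0 hp n
  rw [baileySum_thetaTerm_self hp0 hp] at hself
  rw [qPoch_succ, ← mul_assoc, mul_inv, eq_mul_inv_iff_mul_eq₀ h2, mul_comm, hself]

end baileyPair

section tripleTerm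

variable {q : ℂ}

/-- The general term of the triple series, at `n = (i, j, k)`. -/
noncomputable def tripleTerm (q : ℂ) (n : ℕ × ℕ × ℕ) : ℂ :=
  q ^ (n.1 ^ 2 + 2 * n.2.1 ^ 2 + 4 * n.2.2 ^ 2 + 2 * n.1 * n.2.2 + 4 * n.2.1 * n.2.2 +
      2 * n.2.1 + 2 * n.2.2) * (1 + q ^ (2 * n.1 + 2 * n.2.1 + 4 * n.2.2 + 2)) /
    (qPoch (q ^ 2) (q ^ 2) n.1 * qPoch (q ^ 2) (q ^ 2) n.2.1 * qPoch (q ^ 4) (q ^ 4) n.2.2)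

theorem summable_tripleTerm (hq : ‖q‖ < 1) : Summable (tripleTerm q) := by
  have hq2 := norm_pow_lt_one hq two_ne_zero
  have hq4 := norm_pow_lt_one hq four_ne_zero
  obtain ⟨A, hA⟩ := exists_norm_inv_qPoch_le hq2 hq2
  obtain ⟨B, hB⟩ := exists_norm_inv_qPoch_le hq4 hq4
  have hgeom : Summable fun n : ℕ => ‖q ^ n‖ := by
    simpa only [norm_pow] using summable_geometric_of_lt_one (norm_nonneg q) hq
  have hmajorant := hgeom.mul_norm (hgeom.mul_norm hgeom)
  refine .of_norm_bounded (hmajorant.mul_right (2 * (A * A * B))) fun ⟨i, j, k⟩ => ?_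
  rw [tripleTerm, div_eq_mul_inv, mul_inv, mul_inv, mul_assoc]
  have hpow : ‖q ^ (i ^ 2 + 2 * j ^ 2 + 4 * k ^ 2 + 2 * i * k + 4 * j * k + 2 * j + 2 * k)‖ ≤
      ‖q ^ i * (q ^ j * q ^ k)‖ := by
    rw [← pow_add, ← pow_add, norm_pow, norm_pow]
    exact pow_le_pow_of_le_one (norm_nonneg q) hq.le (by nlinarith [Nat.le_self_pow two_ne_zero i])
  have htwo : ‖1 + q ^ (2 * i + 2 * j + 4 * k + 2)‖ ≤ 2 := by
    calc _ ≤ ‖(1 : ℂ)‖ + ‖q ^ (2 * i + 2 * j + 4 * k + 2)‖ := norm_add_le _ _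
      _ ≤ 1 + 1 := by
        rw [norm_one, norm_pow]
        gcongr
        exact pow_le_one₀ (norm_nonneg q) hq.le
      _ = 2 := one_add_one_eq_two
  exact norm_mul_le_of_le hpow (norm_mul_le_of_le htwo
    (norm_mul_le_of_le (norm_mul_le_of_le (hA i) (hA j)) (hB k)))

theorem hasSum_tripleTerm_fst (hq0 : q ≠ 0) (hq : ‖q‖ < 1) (j k : ℕ) :
    HasSum (fun i => tripleTerm q (i, j, k))
      (qPochInf (-q) (q ^ 2) *
        (q ^ (2 * j ^ 2 + 4 * k ^ 2 + 4 * j * k + 2 * j + 2 * k) /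
            (qPoch (q ^ 2) (q ^ 2) j * qPoch (q ^ 4) (q ^ 4) k) *
          ((qPoch (-q) (q ^ 2) k)⁻¹ +
            q ^ (2 * j + 4 * k + 2) * (qPoch (-q) (q ^ 2) (k + 1))⁻¹))) := by
  have hq2 := norm_pow_lt_one hq two_ne_zero
  have hEuler (c : ℂ) (m : ℕ) : HasSum
      (fun i : ℕ => c * (q ^ i ^ 2 * ((q ^ 2) ^ m) ^ i / qPoch (q ^ 2) (q ^ 2) i))
      (qPochInf (-q) (q ^ 2) * (c * (qPoch (-q) (q ^ 2) m)⁻¹)) := by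
    rw [← qPoch_mul_qPochInf (-q) hq2 m, mul_left_comm, mul_comm (qPoch _ _ m), mul_assoc,
      mul_inv_cancel₀ (qPoch_ne_zero ((norm_neg q).trans_lt hq) hq2 m), mul_one, neg_mul]
    exact (hasSum_pow_sq_mul_pow_div_qPoch hq0 hq (pow_ne_zero m (pow_ne_zero 2 hq0))).mul_left c
  rw [mul_add, mul_add, ← mul_assoc _ (q ^ (2 * j + 4 * k + 2))]
  refine ((hEuler _ k).add (hEuler _ (k + 1))).congr_fun fun i => ?_
  rw [tripleTerm]
  ring

theorem hasSum_tripleTerm_zero :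
    HasSum (tripleTerm 0) (qPochInf₃ (0 ^ 3) (0 ^ 8) (0 ^ 11) (0 ^ 11) /
      (qPochInf 0 (0 ^ 2) * qPochInf (0 ^ 4) (0 ^ 4))) := by
  have hvalue : qPochInf₃ (0 ^ 3) (0 ^ 8) (0 ^ 11) (0 ^ 11) /
      (qPochInf 0 (0 ^ 2) * qPochInf (0 ^ 4) (0 ^ 4)) = tripleTerm 0 (0, 0, 0) := by
    simp [qPochInf₃, qPochInf, tripleTerm, qPoch]
  rw [hvalue]
  refine hasSum_single _ ?_
  rintro ⟨i, j, k⟩ h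
  rw [tripleTerm, zero_pow, zero_mul, zero_div]
  contrapose! h
  simp_all

end tripleTerm

section reduction

variable {p : ℂ}

theorem baileyChainTerm_natCast (hp0 : p ≠ 0) (hp : ‖p‖ < 1) (j k : ℕ) :
    baileyChainTerm (p ^ 4) (thetaTerm (p ^ 3) (-p)) ((j + k : ℕ), k) =
      (p ^ 2) ^ (2 * j ^ 2 + 4 * k ^ 2 + 4 * j * k + 2 * j + 2 * k) /
          (qPoch (p ^ 4) (p ^ 4) j * qPoch (p ^ 8) (p ^ 8) k) *
        ((qPoch (-p ^ 2) (p ^ 4) k)⁻¹ +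
          (p ^ 2) ^ (2 * j + 4 * k + 2) * (qPoch (-p ^ 2) (p ^ 4) (k + 1))⁻¹) := by
  have hzpow : (p ^ 4) ^ (((j + k : ℕ) : ℤ) + 1) = (p ^ 4) ^ (j + k + 1) :=
    mod_cast zpow_natCast (p ^ 4) (j + k + 1)
  have hsub : ((j + k : ℕ) : ℤ) - k = j := by lia
  rw [baileyChainTerm, hzpow, hsub, invQPoch_natCast, baileySum_thetaTerm_self_eq_inv hp0 hp,
    baileySum_thetaTerm_add_one_eq_inv hp0 hp]
  simp only [thetaTerm_natCast]
  ring

theorem hasSum_tripleTerm_sq (hp0 : p ≠ 0) (hp : ‖p‖ < 1) :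
    HasSum (tripleTerm (p ^ 2)) (qPochInf (-p ^ 2) (p ^ 4) *
      ((qPochInf (p ^ 4) (p ^ 4))⁻¹ * ∑' r, thetaTerm (p ^ 11) (-p ^ 5) r)) := by
  have hQ0 := pow_ne_zero 4 hp0
  have hp2 := norm_pow_lt_one hp two_ne_zero
  have hp3 := norm_pow_lt_one hp three_ne_zero
  have hQ := norm_pow_lt_one hp four_ne_zero
  have hfiber (n : ℕ × ℕ) : HasSum (fun i => tripleTerm (p ^ 2) (i, n))
      (qPochInf (-p ^ 2) (p ^ 4) *
        baileyChainTerm (p ^ 4) (thetaTerm (p ^ 3) (-p)) ((n.1 + n.2 : ℕ), n.2)) := by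
    rw [baileyChainTerm_natCast hp0 hp]
    simpa only [← pow_mul] using hasSum_tripleTerm_fst (pow_ne_zero 2 hp0) hp2 n.1 n.2
  have hchain := hasSum_baileyChainTerm_natCast hQ0 hQ
    (summable_thetaTerm (pow_ne_zero 3 hp0) hp3 (neg_ne_zero.2 hp0))
  have hsum := summable_tripleTerm hp2
  have hfibers := ((Equiv.prodComm _ _).hasSum_iff.2 hsum.hasSum).prod_fiberwise hfiber
  have hx : (p ^ 4) ^ 2 * p ^ 3 = p ^ 11 := by ring
  have hz : p ^ 4 * -p = -p ^ 5 := by ring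
  simp only [thetaTerm_mul_thetaTerm, hx, hz] at hchain
  rw [(hchain.mul_left _).unique hfibers]
  exact hsum.hasSum

theorem tsum_thetaTerm_pow_eleven (hp0 : p ≠ 0) (hp : ‖p‖ < 1) :
    ∑' r, thetaTerm (p ^ 11) (-p ^ 5) r =
      qPochInf₃ ((p ^ 2) ^ 3) ((p ^ 2) ^ 8) ((p ^ 2) ^ 11) ((p ^ 2) ^ 11) := by
  have hxz : -(p ^ 11 * -p ^ 5) = (p ^ 2) ^ 8 := by ring
  have hxz_inv : -(p ^ 11 * (-p ^ 5)⁻¹) = (p ^ 2) ^ 3 := by field_simp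
  rw [jacobi_triple_product (pow_ne_zero 11 hp0) (norm_pow_lt_one hp (by decide))
    (neg_ne_zero.2 (pow_ne_zero 5 hp0)), hxz, hxz_inv, pow_right_comm p 11 2, qPochInf₃,
    mul_comm (qPochInf ((p ^ 2) ^ 3) _)]

end reduction

theorem mainTheorem5 (q : ℂ) (hq : ‖q‖ < 1) :
    HasSum
      (fun n : ℕ × ℕ × ℕ =>
        let i := n.1
        let j := n.2.1
        let k := n.2.2
        q ^ (i ^ 2 + 2 * j ^ 2 + 4 * k ^ 2 + 2 * i * k + 4 * j * k + 2 * j + 2 * k) *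
            (1 + q ^ (2 * i + 2 * j + 4 * k + 2)) /
          (qPoch (q ^ 2) (q ^ 2) i * qPoch (q ^ 2) (q ^ 2) j * qPoch (q ^ 4) (q ^ 4) k))
      (qPochInf₃ (q ^ 3) (q ^ 8) (q ^ 11) (q ^ 11) /
        (qPochInf q (q ^ 2) * qPochInf (q ^ 4) (q ^ 4))) := by
  rcases eq_or_ne q 0 with rfl | hq0
  · exact hasSum_tripleTerm_zero
  obtain ⟨p, rfl⟩ := IsAlgClosed.exists_pow_nat_eq q two_pos
  have hp0 := (pow_ne_zero_iff two_ne_zero).1 hq0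
  have hp : ‖p‖ < 1 := by rwa [norm_pow, pow_lt_one_iff_of_nonneg (norm_nonneg p) two_ne_zero] at hq
  have h := hasSum_tripleTerm_sq hp0 hp
  rw [tsum_thetaTerm_pow_eleven hp0 hp, show p ^ 4 = (p ^ 2) ^ 2 from pow_mul p 2 2, ← mul_assoc,
    qPochInf_neg_mul_inv hq, ← div_eq_inv_mul] at h
  exact h
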